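/- All graphs are finite, simple and undirected; $\Delta(G)$ denotes the maximum degree of $G$. A $k$-star colouring of $G$ is a map $f\colon V(G)\to\{0,\dots,k-1\}$ with $f(u)\ne f(v)$ for every edge $uv$ and such that there is no path $u,v,w,x$ on four distinct vertices of $G$ with $f(u)=f(w)$ and $f(v)=f(x)$. For integers $k\ge 1$ and $d\ge 0$, let $k$-Star Colourability$(\Delta=d)$ be the decision problem whose instances are the graphs $G$ with $\Delta(G)=d$ (on a vertex set $\{0,\dots,n-1\}$, given by the adjacency matrix) and which asks whether $G$ has a $k$-star colouring. It is polynomial-time solvable if a Turing machine, given any instance, answers correctly in time polynomial in the length of the input; it is NP-complete if its yes-instances are those instances that have polynomial-length certificates accepted by a polynomial-time verifier, and every language in NP reduces to it by a polynomial-time many-one reduction that maps strings to instances. For $k\ge 3$, let $L_s^{(k)}$ be the least integer $d$ such that $k$-Star Colourability$(\Delta=d)$ is NP-complete. (i) Let $k\ge 1$ and $d\ge 0$ be integers with $d\le 0.33\,k^{2/3}$. Then every graph of maximum degree $d$ is $k$-star colourable, and $k$-Star Colourability$(\Delta=d)$ is polynomial-time solvable. (ii) For every $k\ge 3$, if $L=L_s^{(k)}$,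 that is, if $L$ is the least integer $d$ such that $k$-Star Colourability$(\Delta=d)$ is NP-complete, then $L>0.33\,k^{2/3}$. -/

import Mathlib

namespace StarColouring

/-- A `k`-star colouring of `G`: a proper colouring with colours `0, …, k-1` such that no path
`u, v, w, x` on four (distinct) vertices satisfies `f u = f w` and `f v = f x`. -/
def IsStarColouring {V : Type*} (G : SimpleGraph V) (k : ℕ) (f : V → Fin k) : Prop :=
  (∀ u v, G.Adj u v → f u ≠ f v) ∧
    ∀ u v w x, G.Adj u v → G.Adj v w → G.Adj w x → [u, v, w, x].Nodup →
      ¬ (f u = f w ∧ f v = f x)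

/-- `G` admits a `k`-star colouring. -/
def IsStarColourable {V : Type*} (G : SimpleGraph V) (k : ℕ) : Prop :=
  ∃ f : V → Fin k, IsStarColouring G k f

/-- A decision problem: a type of instances, each represented by a binary string, and the set of
yes-instances. -/
structure DecisionProblem where
  /-- the instances -/
  Instance : Type
  /-- the binary string that represents an instance -/
  encode : Instance → List Bool
  encode_injective : Function.Injective encode
  /-- the yes-instances -/
  Yes : Instance → Prop

namespace DecisionProblem

/-- The decision problem of membership in a language over `{0, 1}`: every string is an instance. -/
def ofLanguage (L : Language Bool) : DecisionProblem where
  Instance := List Bool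
  encode := id
  encode_injective := Function.injective_id
  Yes x := x ∈ L

open Classical in
/-- `P` is polynomial-time solvable: some Turing machine, given (the string that represents) any
instance of `P`, outputs in time polynomial in the length of that string whether it is a
yes-instance. -/
def InP (P : DecisionProblem) : Prop :=
  Nonempty (Turing.TM2ComputableInPolyTime P.encode Computability.encodeBool
    (fun x => decide (P.Yes x)))

/-- The string `x#w` representing an instance `x` together with a certificate `w`; the separator
`#` is `none`. -/
def encodeWithCertificate (P : DecisionProblem) (xw : P.Instance × List Bool) :
    List (Option Bool) :=
  (P.encode xw.1).map some ++ none :: xw.2.map some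

/-- `P` is in NP: there is a polynomial-time verifier `R` such that the yes-instances are exactly
the instances that have a certificate of polynomial length accepted by `R`. -/
def InNP (P : DecisionProblem) : Prop :=
  ∃ (q : Polynomial ℕ) (R : P.Instance × List Bool → Bool),
    Nonempty (Turing.TM2ComputableInPolyTime P.encodeWithCertificate
      Computability.encodeBool R) ∧
    ∀ x, P.Yes x ↔ ∃ w : List Bool, w.length ≤ q.eval (P.encode x).length ∧ R (x, w) = true

/-- Polynomial-time many-one (Karp) reducibility. -/
def Reduces (P Q : DecisionProblem) : Prop :=
  ∃ f : P.Instance → Q.Instance,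
    Nonempty (Turing.TM2ComputableInPolyTime P.encode Q.encode f) ∧
    ∀ x, P.Yes x ↔ Q.Yes (f x)

/-- `P` is NP-complete: it is in NP, and every language in NP reduces to it. -/
def NPComplete (P : DecisionProblem) : Prop :=
  P.InNP ∧ ∀ L : Language Bool, (ofLanguage L).InNP → (ofLanguage L).Reduces P

end DecisionProblem

open Classical in
/-- The finite simple graphs of maximum degree `d`, on the vertex sets `{0, …, n-1}`. -/
def GraphOfMaxDegree (d : ℕ) : Type :=
  {G : Σ n : ℕ, SimpleGraph (Fin n) // G.2.maxDegree = d}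

open Classical in
/-- The adjacency matrix of a graph on `{0, …, n-1}`, written row by row as a string of `n²`
bits. -/
noncomputable def adjacencyString (G : Σ n : ℕ, SimpleGraph (Fin n)) : List Bool :=
  List.ofFn fun p : Fin (G.1 * G.1) => decide (G.2.Adj p.divNat p.modNat)

theorem adjacencyString_injective : Function.Injective adjacencyString := by
  rintro ⟨n, G⟩ ⟨m, H⟩ h
  have hl := congrArg List.length h
  simp only [adjacencyString, List.length_ofFn] at hl
  have hnm : n = m := Nat.mul_self_inj.mp hl
  subst hnm
  have hf := List.ofFn_injective h
  have : G = H := by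
    ext i j
    have := congrFun hf (finProdFinEquiv (i, j))
    have e := finProdFinEquiv.symm_apply_apply (i, j)
    simp only [finProdFinEquiv_symm_apply, Prod.mk.injEq] at e
    simpa [e.1, e.2] using this
  rw [this]

/-- `k`-Star Colourability restricted to graphs of maximum degree `d`: given a graph of maximum
degree `d`, is it `k`-star colourable? -/
noncomputable def starColourability (k d : ℕ) : DecisionProblem where
  Instance := GraphOfMaxDegree d
  encode G := adjacencyString G.1
  encode_injective := adjacencyString_injective.comp Subtype.val_injective
  Yes G := IsStarColourable G.1.2 k

/-- `L` is the number `L_s^{(k)}`: the least `d` such that `k`-Star Colourability is NP-complete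
for graphs of maximum degree `d`. -/
def IsLeastHardDegree (k L : ℕ) : Prop :=
  IsLeast {d : ℕ | (starColourability k d).NPComplete} L

end StarColouring

/-! Counting replaces a probabilistic argument. Let `N` be the number of star colourings of the
subgraph induced by `S`, and add a vertex `v`. Of the `k * N` extensions, at most `d * N` clash with
a neighbour of `v`. Any other failure creates a bicoloured path through `v`, with `v` as an end or
as an inner vertex: at most `d ^ 3` walks of each kind. Such a failure is determined by its
restriction to `S` minus one vertex `x` of the path, and by induction that set has at most `2 * N /
k` star colourings. If `2dk + 8d³ ≤ k²`, at least `k * N / 2` extensions survive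
(`mul_card_starColourings_le_two_mul`), so a colouring exists. Hence every instance is a
yes-instance: a constant machine decides the problem, and the empty language cannot reduce to it. -/

namespace StarColouring

/-! ### Counting star colourings vertex by vertex -/

section Counting

variable {V : Type*} (G : SimpleGraph V) {k : ℕ}

/-- `f` restricts to a star colouring of the subgraph of `G` induced by `S`. -/
def IsStarColouringOn (S : Finset V) (f : V → Fin k) : Prop :=
  (∀ u ∈ S, ∀ v ∈ S, G.Adj u v → f u ≠ f v) ∧
    ∀ u ∈ S, ∀ v ∈ S, ∀ w ∈ S, ∀ x ∈ S, G.Adj u v → G.Adj v w → G.Adj w x →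
      [u, v, w, x].Nodup → ¬ (f u = f w ∧ f v = f x)

variable {G} in
theorem IsStarColouringOn.congr_of_subset {S T : Finset V} {f g : V → Fin k}
    (hf : IsStarColouringOn G S f) (hTS : T ⊆ S) (h : ∀ u ∈ T, g u = f u) :
    IsStarColouringOn G T g := by
  refine ⟨fun u hu v hv huv => ?_, fun u hu v hv w hw x hx h₁ h₂ h₃ h₄ => ?_⟩
  · rw [h u hu, h v hv]
    exact hf.1 u (hTS hu) v (hTS hv) huv
  · rw [h u hu, h v hv, h w hw, h x hx]
    exact hf.2 u (hTS hu) v (hTS hv) w (hTS hw) x (hTS hx) h₁ h₂ h₃ h₄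

variable [Fintype V] [DecidableEq V]

open Classical in
/-- The star colourings of the subgraph induced by `S`, extended by the colour `c₀` outside `S`. -/
noncomputable def starColourings (c₀ : Fin k) (S : Finset V) : Finset (V → Fin k) :=
  {f | IsStarColouringOn G S f ∧ ∀ u ∉ S, f u = c₀}

variable (c₀ : Fin k)

theorem mem_starColourings {S : Finset V} {f : V → Fin k} :
    f ∈ starColourings G c₀ S ↔ IsStarColouringOn G S f ∧ ∀ u ∉ S, f u = c₀ := by
  classical
  simp [starColourings]

theorem update_mem_starColourings_erase {S : Finset V} {f : V → Fin k}
    (hf : f ∈ starColourings G c₀ S) (x : V) :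
    Function.update f x c₀ ∈ starColourings G c₀ (S.erase x) := by
  rw [mem_starColourings] at hf ⊢
  refine ⟨hf.1.congr_of_subset (Finset.erase_subset _ _) fun u hu => ?_, fun u hu => ?_⟩
  · exact Function.update_of_ne (Finset.ne_of_mem_erase hu) _ _
  · by_cases hux : u = x
    · simp [hux]
    · rw [Function.update_of_ne hux]
      exact hf.2 u fun h => hu (Finset.mem_erase.2 ⟨hux, h⟩)

/-- The pairs of a star colouring `g` of `S` and a colour `c` for which `c = g z` and
`g x = g b`. -/
noncomputable def repeatedPairs (S : Finset V) (x b z : V) : Finset ((V → Fin k) × Fin k) :=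
  {p ∈ starColourings G c₀ S ×ˢ Finset.univ |
    (x ∈ S ∧ b ≠ x ∧ z ≠ x) ∧ p.2 = p.1 z ∧ p.1 x = p.1 b}

/-- Forgetting the colour of `x` is injective here: `b ≠ x` keeps its colour and returns that of
`x`, and then `z` returns `c`. For degenerate triples the set is empty, so the bound holds for every
triple and can be summed over all walks. -/
theorem card_repeatedPairs_le {S : Finset V} {M : ℕ}
    (hM : ∀ x ∈ S, (starColourings G c₀ (S.erase x)).card ≤ M) (x b z : V) :
    (repeatedPairs G c₀ S x b z).card ≤ M := by
  by_cases h : x ∈ S ∧ b ≠ x ∧ z ≠ x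
  · obtain ⟨hx, hb, hz⟩ := h
    refine le_trans (Finset.card_le_card_of_injOn (fun p => Function.update p.1 x c₀) ?_ ?_)
      (hM x hx)
    · intro p hp
      simp only [repeatedPairs, Finset.coe_filter, Finset.mem_product, Set.mem_ofPred_eq] at hp
      exact update_mem_starColourings_erase G c₀ hp.1.1 x
    · rintro ⟨g, c⟩ hp ⟨g', c'⟩ hp' heq
      simp only [repeatedPairs, Finset.coe_filter, Finset.mem_product, Set.mem_ofPred_eq] at hp hp'
      have key : ∀ u, u ≠ x → g u = g' u := fun u hu => by
        have := congrFun heq u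
        simpa [Function.update_of_ne hu] using this
      have hg : g = g' := by
        funext u
        by_cases hu : u = x
        · rw [hu, hp.2.2.2, hp'.2.2.2, key b hb]
        · exact key u hu
      rw [hp.2.2.1, hp'.2.2.1, hg]
  · have : repeatedPairs G c₀ S x b z = ∅ := by
      simp [repeatedPairs, h]
    simp [this]

/-- The pairs of a star colouring `g` of `S` and a colour `c` for which `c = g u`. -/
noncomputable def clashingPairs (S : Finset V) (u : V) : Finset ((V → Fin k) × Fin k) :=
  {p ∈ starColourings G c₀ S ×ˢ Finset.univ | p.2 = p.1 u}

theorem card_clashingPairs_le (S : Finset V) (u : V) :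
    (clashingPairs G c₀ S u).card ≤ (starColourings G c₀ S).card := by
  refine Finset.card_le_card_of_injOn Prod.fst ?_ ?_
  · intro p hp
    simp only [clashingPairs, Finset.coe_filter, Finset.mem_product, Set.mem_ofPred_eq] at hp
    exact hp.1.1
  · rintro ⟨g, c⟩ hp ⟨g', c'⟩ hp' heq
    simp only [clashingPairs, Finset.coe_filter, Finset.mem_product, Set.mem_ofPred_eq] at hp hp'
    have hg : g = g' := heq
    rw [hp.2, hp'.2, hg]

variable [DecidableRel G.Adj]

/-- If colouring `v` with `c` does not extend the star colouring `g` of `S`, then `c` clashes with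
a neighbour of `v` or `v` is on a bicoloured path, as an end or as an inner vertex. -/
theorem mem_of_update_notMem {S : Finset V} {v : V} (hv : v ∉ S) {g : V → Fin k} {c : Fin k}
    (hg : g ∈ starColourings G c₀ S)
    (h : Function.update g v c ∉ starColourings G c₀ (insert v S)) :
    (∃ u, G.Adj v u ∧ (g, c) ∈ clashingPairs G c₀ S u) ∨
    (∃ b z x, G.Adj v b ∧ G.Adj b z ∧ G.Adj z x ∧ (g, c) ∈ repeatedPairs G c₀ S x b z) ∨
    (∃ x b z, G.Adj v x ∧ G.Adj v b ∧ G.Adj b z ∧ (g, c) ∈ repeatedPairs G c₀ S x b z) := by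
  have hg' := hg
  rw [mem_starColourings] at hg'
  by_contra! hcon
  obtain ⟨h₁, h₂, h₃⟩ := hcon
  simp only [clashingPairs, repeatedPairs, Finset.mem_filter, Finset.mem_product, hg,
    Finset.mem_univ, true_and, and_true, not_and] at h₁ h₂ h₃
  have hne : ∀ u ∈ S, Function.update g v c u = g u := fun u hu =>
    Function.update_of_ne (ne_of_mem_of_not_mem hu hv) _ _
  have hself : Function.update g v c v = c := Function.update_self _ _ _
  have hnv : ∀ u ∈ insert v S, u ≠ v → u ∈ S := fun u hu hne => by
    simpa [hne] using hu
  -- Reversing a path leaves only two positions for `v`: first (`hend`) or second (`hinner`).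
  have hend : ∀ b ∈ S, ∀ z ∈ S, ∀ x ∈ S, G.Adj v b → G.Adj b z → G.Adj z x → b ≠ x →
      c = g z → g b = g x → False := fun b _ z _ x hx a₁ a₂ a₃ e e₁ e₂ =>
    h₂ b z x a₁ a₂ a₃ ⟨hx, e, a₃.ne⟩ e₁ e₂.symm
  have hinner : ∀ x ∈ S, ∀ b ∈ S, ∀ z ∈ S, G.Adj v x → G.Adj v b → G.Adj b z → b ≠ x → z ≠ x →
      c = g z → g x = g b → False := fun x hx b _ z _ a₁ a₂ a₃ e e' e₁ e₂ =>
    h₃ x b z a₁ a₂ a₃ ⟨hx, e, e'⟩ e₁ e₂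
  refine h ((mem_starColourings G c₀).2 ⟨⟨?_, ?_⟩, fun u hu => ?_⟩)
  · intro u hu w hw huw heq
    by_cases hu' : u = v
    · subst hu'
      have hw' := hnv w hw huw.ne'
      rw [hself, hne w hw'] at heq
      exact h₁ w huw heq
    · have hu'' := hnv u hu hu'
      by_cases hw' : w = v
      · subst hw'
        rw [hself, hne u hu''] at heq
        exact h₁ u huw.symm heq.symm
      · have hw'' := hnv w hw hw'
        rw [hne u hu'', hne w hw''] at heq
        exact hg'.1.1 u hu'' w hw'' huw heq
  · intro a ha b hb p hp q hq hab hbp hpq hnd heq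
    have hnd' := hnd
    simp only [List.nodup_cons, List.mem_cons, List.not_mem_nil, not_or, or_false,
      not_false_eq_true, List.nodup_nil, and_true] at hnd
    obtain ⟨⟨hab', hap, haq⟩, ⟨hbp', hbq⟩, hpq'⟩ := hnd
    by_cases ha' : a = v
    · subst ha'
      have hb' := hnv b hb (Ne.symm hab')
      have hp' := hnv p hp (Ne.symm hap)
      have hq' := hnv q hq (Ne.symm haq)
      rw [hself, hne b hb', hne p hp', hne q hq'] at heq
      exact hend b hb' p hp' q hq' hab hbp hpq hbq heq.1 heq.2
    have ha'' := hnv a ha ha'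
    by_cases hb' : b = v
    · subst hb'
      have hp' := hnv p hp (Ne.symm hbp')
      have hq' := hnv q hq (Ne.symm hbq)
      rw [hself, hne a ha'', hne p hp', hne q hq'] at heq
      exact hinner a ha'' p hp' q hq' hab.symm hbp hpq (Ne.symm hap) (Ne.symm haq) heq.2 heq.1
    have hb'' := hnv b hb hb'
    by_cases hp' : p = v
    · subst hp'
      have hq' := hnv q hq (Ne.symm hpq')
      rw [hself, hne a ha'', hne b hb'', hne q hq'] at heq
      exact hinner q hq' b hb'' a ha'' hpq hbp.symm hab.symm hbq haq heq.1.symm heq.2.symm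
    have hp'' := hnv p hp hp'
    by_cases hq' : q = v
    · subst hq'
      rw [hself, hne a ha'', hne b hb'', hne p hp''] at heq
      exact hend p hp'' b hb'' a ha'' hpq.symm hbp.symm hab.symm (Ne.symm hap) heq.2.symm
        heq.1.symm
    have hq'' := hnv q hq hq'
    rw [hne a ha'', hne b hb'', hne p hp'', hne q hq''] at heq
    exact hg'.1.2 a ha'' b hb'' p hp'' q hq'' hab hbp hpq hnd' heq
  · have hu' : u ≠ v := fun e => hu (e ▸ Finset.mem_insert_self _ _)
    rw [Function.update_of_ne hu']
    exact hg'.2 u fun e => hu (Finset.mem_insert_of_mem e)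

/-- Of the `k * N` ways to extend one of the `N` star colourings of `S` to a further vertex, few
are not star colourings. -/
theorem mul_card_starColourings_le {d M : ℕ} (hd : ∀ v, G.degree v ≤ d) {S : Finset V} {v : V}
    (hv : v ∉ S) (hM : ∀ x ∈ S, (starColourings G c₀ (S.erase x)).card ≤ M) :
    k * (starColourings G c₀ S).card ≤ (starColourings G c₀ (insert v S)).card +
      (d * (starColourings G c₀ S).card + (d * (d * (d * M)) + d * (d * (d * M)))) := by
  classical
  let N := G.neighborFinset
  have hN : ∀ u, (N u).card ≤ d := fun u => by
    simpa [N, SimpleGraph.card_neighborFinset_eq_degree] using hd u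
  have bnd : ∀ (u : V) (F : V → Finset ((V → Fin k) × Fin k)) (m : ℕ),
      (∀ w, (F w).card ≤ m) → ((N u).biUnion F).card ≤ d * m := fun u F m hF =>
    (Finset.card_biUnion_le_card_mul _ _ m fun w _ => hF w).trans
      (Nat.mul_le_mul_right _ (hN u))
  let all : Finset ((V → Fin k) × Fin k) := starColourings G c₀ S ×ˢ Finset.univ
  let good := {p ∈ all | Function.update p.1 v p.2 ∈ starColourings G c₀ (insert v S)}
  let B₁ := (N v).biUnion fun u => clashingPairs G c₀ S u
  let B₂ := (N v).biUnion fun b => (N b).biUnion fun z => (N z).biUnion fun x =>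
    repeatedPairs G c₀ S x b z
  let B₃ := (N v).biUnion fun x => (N v).biUnion fun b => (N b).biUnion fun z =>
    repeatedPairs G c₀ S x b z
  have hB₁ : B₁.card ≤ d * (starColourings G c₀ S).card :=
    bnd _ _ _ fun u => card_clashingPairs_le G c₀ S u
  have hB₂ : B₂.card ≤ d * (d * (d * M)) :=
    bnd _ _ _ fun b => bnd _ _ _ fun z => bnd _ _ _ fun x => card_repeatedPairs_le G c₀ hM x b z
  have hB₃ : B₃.card ≤ d * (d * (d * M)) :=
    bnd _ _ _ fun x => bnd _ _ _ fun b => bnd _ _ _ fun z => card_repeatedPairs_le G c₀ hM x b z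
  have hgood : good.card ≤ (starColourings G c₀ (insert v S)).card := by
    refine Finset.card_le_card_of_injOn (fun p => Function.update p.1 v p.2) ?_ ?_
    · intro p hp
      simp only [good, Finset.coe_filter, Set.mem_ofPred_eq] at hp
      exact hp.2
    · rintro ⟨g, c⟩ hp ⟨g', c'⟩ hp' heq
      simp only [good, all, Finset.coe_filter, Set.mem_ofPred_eq, Finset.mem_product,
        mem_starColourings] at hp hp'
      have hc : c = c' := by simpa using congrFun heq v
      have hg : g = g' := by
        funext u
        by_cases hu : u = v
        -- The old value at `v ∉ S` is the default `c₀`, so overwriting it loses nothing.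
        · rw [hu, hp.1.1.2 v hv, hp'.1.1.2 v hv]
        · simpa [Function.update_of_ne hu] using congrFun heq u
      rw [hc, hg]
  have hsub : all ⊆ good ∪ (B₁ ∪ (B₂ ∪ B₃)) := by
    rintro ⟨g, c⟩ hp
    by_cases h : Function.update g v c ∈ starColourings G c₀ (insert v S)
    · exact Finset.mem_union_left _ (Finset.mem_filter.2 ⟨hp, h⟩)
    · refine Finset.mem_union_right _ ?_
      have hg : g ∈ starColourings G c₀ S := (Finset.mem_product.1 hp).1
      simp only [B₁, B₂, B₃, N, Finset.mem_union, Finset.mem_biUnion,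
        SimpleGraph.mem_neighborFinset]
      rcases mem_of_update_notMem G c₀ hv hg h with ⟨u, a, h⟩ | ⟨b, z, x, a₁, a₂, a₃, h⟩ |
        ⟨x, b, z, a₁, a₂, a₃, h⟩
      · exact Or.inl ⟨u, a, h⟩
      · exact Or.inr (Or.inl ⟨b, a₁, z, a₂, x, a₃, h⟩)
      · exact Or.inr (Or.inr ⟨x, a₁, b, a₂, z, a₃, h⟩)
  calc k * (starColourings G c₀ S).card = all.card := by
        simp [all, Finset.card_product, mul_comm]
    _ ≤ (good ∪ (B₁ ∪ (B₂ ∪ B₃))).card := Finset.card_le_card hsub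
    _ ≤ good.card + (B₁.card + (B₂.card + B₃.card)) := by
        refine (Finset.card_union_le _ _).trans (Nat.add_le_add_left ?_ _)
        refine (Finset.card_union_le _ _).trans (Nat.add_le_add_left ?_ _)
        exact Finset.card_union_le _ _
    _ ≤ _ := by gcongr

/-- Each new vertex multiplies the number of star colourings by at least `k / 2`. -/
theorem mul_card_starColourings_le_two_mul {d : ℕ} (hd : ∀ v, G.degree v ≤ d)
    (hk : 2 * d * k + 8 * d ^ 3 ≤ k ^ 2) (S : Finset V) (v : V) (hv : v ∉ S) :
    k * (starColourings G c₀ S).card ≤ 2 * (starColourings G c₀ (insert v S)).card := by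
  induction S using Finset.strongInduction generalizing v with
  | H S ih =>
    have hkpos : 0 < k := c₀.pos
    set n := (starColourings G c₀ S).card with hn
    -- The induction hypothesis for putting `x` back into `S.erase x`.
    have hM : ∀ x ∈ S, (starColourings G c₀ (S.erase x)).card ≤ 2 * n / k := fun x hx => by
      rw [Nat.le_div_iff_mul_le hkpos, mul_comm]
      have := ih (S.erase x) (Finset.erase_ssubset hx) x (Finset.notMem_erase x S)
      rwa [Finset.insert_erase hx] at this
    have h := mul_card_starColourings_le G c₀ hd hv hM
    rw [← hn] at h
    generalize (starColourings G c₀ (insert v S)).card = m at h ⊢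
    have hq : k * (2 * n / k) ≤ 2 * n := Nat.mul_div_le _ _
    generalize 2 * n / k = q at h hq
    have h₁ : k * (k * n) ≤ k * m + k * d * n + 2 * d ^ 3 * (k * q) := by
      calc k * (k * n) ≤ _ := Nat.mul_le_mul_left k h
        _ = _ := by ring
    have h₂ : 2 * d ^ 3 * (k * q) ≤ 2 * d ^ 3 * (2 * n) := Nat.mul_le_mul_left _ hq
    have h₃ : (2 * d * k + 8 * d ^ 3) * n ≤ k ^ 2 * n := Nat.mul_le_mul_right _ hk
    refine Nat.le_of_mul_le_mul_left ?_ hkpos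
    nlinarith

/-- A graph of maximum degree at most `d` is `k`-star colourable if `2dk + 8d³ ≤ k²`. -/
theorem isStarColourable_of_degree_le {d : ℕ} (hkpos : 0 < k) (hd : ∀ v, G.degree v ≤ d)
    (hk : 2 * d * k + 8 * d ^ 3 ≤ k ^ 2) : IsStarColourable G k := by
  let c₀ : Fin k := ⟨0, hkpos⟩
  have hpos : ∀ S : Finset V, 0 < (starColourings G c₀ S).card := fun S => by
    induction S using Finset.induction_on with
    | empty =>
      refine Finset.card_pos.2 ⟨fun _ => c₀, (mem_starColourings G c₀).2 ⟨⟨?_, ?_⟩, ?_⟩⟩ <;> simp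
    | insert v S hv ih =>
      have := mul_card_starColourings_le_two_mul G c₀ hd hk S v hv
      have := Nat.mul_pos hkpos ih
      omega
  obtain ⟨f, hf⟩ := Finset.card_pos.1 (hpos Finset.univ)
  obtain ⟨⟨h₁, h₂⟩, -⟩ := (mem_starColourings G c₀).1 hf
  exact ⟨f, fun u v => h₁ u (Finset.mem_univ u) v (Finset.mem_univ v), fun u v w x =>
    h₂ u (Finset.mem_univ u) v (Finset.mem_univ v) w (Finset.mem_univ w) x (Finset.mem_univ x)⟩

end Counting

/-! ### The numerical condition -/

theorem two_mul_add_eight_mul_le_sq {k d : ℕ} (hk : 1 ≤ k)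
    (h : (d : ℝ) ≤ 0.33 * (k : ℝ) ^ ((2 : ℝ) / 3)) : 2 * d * k + 8 * d ^ 3 ≤ k ^ 2 := by
  have hk' : (1 : ℝ) ≤ k := by exact_mod_cast hk
  have hcube : ((k : ℝ) ^ ((2 : ℝ) / 3)) ^ 3 = (k : ℝ) ^ 2 := by
    rw [← Real.rpow_natCast, ← Real.rpow_mul (by positivity), ← Real.rpow_natCast]
    norm_num
  have hle : (k : ℝ) ^ ((2 : ℝ) / 3) ≤ k := by
    simpa using Real.rpow_le_rpow_of_exponent_le hk' (by norm_num : (2 : ℝ) / 3 ≤ 1)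
  have h₁ : (d : ℝ) ≤ 0.33 * k := h.trans (by gcongr)
  have h₂ : (d : ℝ) ^ 3 ≤ 0.33 ^ 3 * (k : ℝ) ^ 2 := by
    calc (d : ℝ) ^ 3 ≤ (0.33 * (k : ℝ) ^ ((2 : ℝ) / 3)) ^ 3 := by gcongr
      _ = _ := by rw [mul_pow, hcube]
  -- The constant suffices because `2 * 0.33 + 8 * 0.33 ^ 3 < 0.95`.
  have : (2 * d * k + 8 * d ^ 3 : ℝ) ≤ (k : ℝ) ^ 2 := by nlinarith
  exact_mod_cast this

/-! ### Constant functions and trivial decision problems -/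

/-- A machine that empties its input stack and then outputs the bit `b`. -/
def constComputer (Γ₀ : Type) [Fintype Γ₀] (b : Bool) : Turing.FinTM2 where
  K := Bool
  k₀ := false
  k₁ := true
  Γ i := cond i Bool Γ₀
  Λ := Unit
  main := ()
  σ := Bool
  initialState := true
  Γk₀Fin := inferInstanceAs (Fintype Γ₀)
  -- The state records whether the pop found a symbol. It is reset to `true` at the end because the
  -- halting configuration requires the initial state.
  m _ := .pop false (fun _ o => o.isSome) <|
    .branch id (.goto fun _ => ()) (.load (fun _ => true) (.push true (fun _ => b) .halt))

/-- The stacks of `constComputer`, with the given input and output stack. -/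
def constComputerStacks {Γ₀ : Type} (l : List Γ₀) (o : List Bool) :
    ∀ i : Bool, List (cond i Bool Γ₀)
  | false => l
  | true => o

/-- One step per symbol, and one more that finds the stack empty, writes `b` and halts. -/
theorem constComputer_iterate_step {Γ₀ : Type} [Fintype Γ₀] (b : Bool) (l : List Γ₀) :
    (flip bind (constComputer Γ₀ b).step)^[l.length + 1]
      (some ⟨some (), true, constComputerStacks l []⟩) =
      some ⟨none, true, constComputerStacks [] [b]⟩ := by
  induction l with
  | nil =>
    refine congrArg some (congrArg (Turing.TM2.Cfg.mk none true) ?_)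
    funext i
    cases i <;> rfl
  | cons a l ih =>
    rw [List.length_cons, Function.iterate_succ_apply, ← ih]
    congr 1
    refine congrArg some (congrArg (Turing.TM2.Cfg.mk (some ()) true) ?_)
    funext i
    cases i <;> rfl

/-- A constant Boolean function is computable in linear time. -/
noncomputable def constComputableInPolyTime {α Γ₀ : Type} [Fintype Γ₀] (ea : α → List Γ₀)
    (b : Bool) :
    Turing.TM2ComputableInPolyTime ea Computability.encodeBool (fun _ => b) where
  tm := constComputer Γ₀ b
  inputAlphabet := Equiv.refl _
  outputAlphabet := Equiv.refl _
  time := Polynomial.X + 1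
  outputsFun a :=
    { steps := (ea a).length + 1
      evals_in_steps := by
        have hinit : Turing.initList (constComputer Γ₀ b) (ea a) =
            ⟨some (), true, constComputerStacks (ea a) []⟩ := by
          refine congrArg (Turing.TM2.Cfg.mk (some ()) true) ?_
          funext i
          cases i <;> rfl
        have hhalt : Turing.haltList (constComputer Γ₀ b) [b] =
            ⟨none, true, constComputerStacks [] [b]⟩ := by
          refine congrArg (Turing.TM2.Cfg.mk none true) ?_
          funext i
          cases i <;> rfl
        have hmap : List.map (Equiv.refl Γ₀).invFun (ea a) = ea a := List.map_id _
        have h := constComputer_iterate_step b (ea a)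
        rw [← hinit, ← hhalt, ← hmap, List.length_map] at h
        exact h
      steps_le_m := by simp }

namespace DecisionProblem

/-- A problem with only yes-instances is solved by the machine that always accepts. -/
theorem inP_of_forall_yes {P : DecisionProblem} (h : ∀ x, P.Yes x) : P.InP := by
  unfold InP
  simp only [h, decide_true]
  exact ⟨constComputableInPolyTime P.encode true⟩

theorem inNP_ofLanguage_bot : (ofLanguage (⊥ : Language Bool)).InNP :=
  ⟨0, fun _ => false, ⟨constComputableInPolyTime _ false⟩, fun _ =>
    ⟨fun h => h.elim, fun ⟨_, _, h⟩ => Bool.noConfusion h⟩⟩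

/-- A problem with only yes-instances is not NP-complete, as the empty language does not reduce
to it. -/
theorem not_npComplete_of_forall_yes {P : DecisionProblem} (h : ∀ x, P.Yes x) :
    ¬ P.NPComplete := fun ⟨_, hP⟩ => by
  obtain ⟨f, -, hf⟩ := hP ⊥ inNP_ofLanguage_bot
  exact (hf ([] : List Bool)).2 (h _)

end DecisionProblem

theorem isStarColourable_of_maxDegree_eq {k d : ℕ} (hk : 1 ≤ k)
    (h : (d : ℝ) ≤ 0.33 * (k : ℝ) ^ ((2 : ℝ) / 3)) {V : Type*} [Fintype V] (G : SimpleGraph V)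
    [DecidableRel G.Adj] (hG : G.maxDegree = d) : IsStarColourable G k := by
  classical
  exact isStarColourable_of_degree_le G hk (fun v => hG ▸ G.degree_le_maxDegree v)
    (two_mul_add_eight_mul_le_sq hk h)

theorem starColourability_yes {k d : ℕ} (hk : 1 ≤ k)
    (h : (d : ℝ) ≤ 0.33 * (k : ℝ) ^ ((2 : ℝ) / 3)) (G : (starColourability k d).Instance) :
    (starColourability k d).Yes G := by
  classical
  exact isStarColourable_of_maxDegree_eq hk h G.1.2 G.2

end StarColouring

theorem mainTheorem11 :
    (∀ k d : ℕ, 1 ≤ k → (d : ℝ) ≤ 0.33 * (k : ℝ) ^ ((2 : ℝ) / 3) →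
      (∀ (V : Type*) [Fintype V] (G : SimpleGraph V) [DecidableRel G.Adj],
        G.maxDegree = d → StarColouring.IsStarColourable G k) ∧
      (StarColouring.starColourability k d).InP) ∧
    (∀ k L : ℕ, 3 ≤ k → StarColouring.IsLeastHardDegree k L →
      0.33 * (k : ℝ) ^ ((2 : ℝ) / 3) < (L : ℝ)) := by
  refine ⟨fun k d hk h => ⟨fun V _ G _ hG =>
    StarColouring.isStarColourable_of_maxDegree_eq hk h G hG,
    StarColouring.DecisionProblem.inP_of_forall_yes
      (StarColouring.starColourability_yes hk h)⟩, fun k L hk hL => ?_⟩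
  by_contra! h
  exact StarColouring.DecisionProblem.not_npComplete_of_forall_yes
    (StarColouring.starColourability_yes (by omega) h) hL.1
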